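/- Let $K$ be a field and let $\mathcal{G} = (G^0, \mathcal{G}^1, r, s)$ be an ultragraph, i.e. $G^0$ (vertices) and $\mathcal{G}^1$ (edges) are countable sets, $s : \mathcal{G}^1 \to G^0$ is a map, and $r$ is a map from $\mathcal{G}^1$ to the set of nonempty subsets of $G^0$. Let $\mathcal{G}^0$ be the smallest collection of subsets of $G^0$ that contains $\varnothing$, all singletons $\{v\}$ with $v\in G^0$ and all sets $r(e)$ with $e\in\mathcal{G}^1$, and that is closed under relative complements, finite unions and finite intersections. The ultragraph Leavitt path algebra $L_K(\mathcal{G})$ is the associative (not necessarily unital) $K$-algebra generated by symbols $p_A$ ($A\in\mathcal{G}^0$), $s_e, s_e^*$ ($e\in\mathcal{G}^1$) subject to the following relations, for all $A,B\in\mathcal{G}^0$ and $e,f\in\mathcal{G}^1$, where $p_v := p_{\{v\}}$: 1. $p_\varnothing = 0$, $p_Ap_B = p_{A\cap B}$, and $p_{A\cup B} = p_A+p_B-p_{A\cap B}$; 2. $p_{s(e)}s_e = s_e = s_ep_{r(e)}$ and $p_{r(e)}s_e^* = s_e^* = s_e^*p_{s(e)}$; 3. $s_e^*s_f = \delta_{e,f}\,p_{r(e)}$;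 4. $p_v = \sum_{s(e)=v}s_es_e^*$ for every $v\in G^0$ with $0<|s^{-1}(v)|<\infty$. Then $L_K(\mathcal{G})$ is semiprimitive: its Jacobson radical $J(L_K(\mathcal{G}))$, the intersection of the annihilators of all simple left $L_K(\mathcal{G})$-modules, is $0$. (A left module $M$ over a ring $R$, possibly without unit, is simple if $RM\neq 0$ and its only submodules are $0$ and $M$.) -/

import Mathlib

/-- An ultragraph with vertex set `V` and edge set `E`. -/
structure Ultragraph (V : Type*) (E : Type*) where
  /-- the source map -/
  s : E → V
  /-- the range map, with values in the nonempty sets of vertices -/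
  r : E → Set V
  r_nonempty : ∀ e, (r e).Nonempty

namespace Ultragraph

/-- The generalized vertices: the smallest collection of sets of vertices that contains all
singletons and all ranges of edges and is closed under relative complements, finite unions
(including the empty one) and finite intersections. -/
inductive IsGenVertex {V E : Type*} (G : Ultragraph V E) : Set V → Prop
  | singleton (v : V) : IsGenVertex G {v}
  | range (e : E) : IsGenVertex G (G.r e)
  | empty : IsGenVertex G ∅
  | diff {A B : Set V} : IsGenVertex G A → IsGenVertex G B → IsGenVertex G (A \ B)
  | union {A B : Set V} : IsGenVertex G A → IsGenVertex G B → IsGenVertex G (A ∪ B)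
  | inter {A B : Set V} : IsGenVertex G A → IsGenVertex G B → IsGenVertex G (A ∩ B)

/-- The symbols `p_A` (for `A` a generalized vertex), `s_e` and `s_e^*` (for `e` an edge). -/
inductive Gen {V E : Type*} (G : Ultragraph V E)
  | p (A : Set V) (hA : G.IsGenVertex A) : Gen G
  | s (e : E) : Gen G
  | sStar (e : E) : Gen G

/-- The free (associative, not necessarily unital) `K`-algebra on the symbols `p_A`, `s_e`,
`s_e^*`: the semigroup algebra of the free semigroup on these symbols. -/
abbrev FreeAlg (K : Type*) [Field K] {V E : Type*} (G : Ultragraph V E) :=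
  MonoidAlgebra K (FreeSemigroup G.Gen)

/-- The symbol `x`, as an element of the free algebra. -/
noncomputable def gen (K : Type*) [Field K] {V E : Type*} {G : Ultragraph V E} (x : G.Gen) :
    FreeAlg K G :=
  MonoidAlgebra.single (FreeSemigroup.of x) 1

/-- The defining relations of the Leavitt path algebra and their scalar multiples. -/
inductive Rel (K : Type*) [Field K] {V E : Type*} (G : Ultragraph V E) :
    FreeAlg K G → FreeAlg K G → Prop
  | p_empty : Rel K G (gen K (.p ∅ .empty)) 0
  | p_mul {A B : Set V} (hA : G.IsGenVertex A) (hB : G.IsGenVertex B) :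
      Rel K G (gen K (.p A hA) * gen K (.p B hB)) (gen K (.p (A ∩ B) (hA.inter hB)))
  | p_union {A B : Set V} (hA : G.IsGenVertex A) (hB : G.IsGenVertex B) :
      Rel K G (gen K (.p (A ∪ B) (hA.union hB)))
        (gen K (.p A hA) + gen K (.p B hB) - gen K (.p (A ∩ B) (hA.inter hB)))
  | source_s (e : E) :
      Rel K G (gen K (.p {G.s e} (.singleton (G.s e))) * gen K (.s e)) (gen K (.s e))
  | s_range (e : E) :
      Rel K G (gen K (.s e) * gen K (.p (G.r e) (.range e))) (gen K (.s e))
  | range_sStar (e : E) :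
      Rel K G (gen K (.p (G.r e) (.range e)) * gen K (.sStar e)) (gen K (.sStar e))
  | sStar_source (e : E) :
      Rel K G (gen K (.sStar e) * gen K (.p {G.s e} (.singleton (G.s e)))) (gen K (.sStar e))
  | sStar_s_self (e : E) :
      Rel K G (gen K (.sStar e) * gen K (.s e)) (gen K (.p (G.r e) (.range e)))
  | sStar_s_of_ne {e f : E} (h : e ≠ f) :
      Rel K G (gen K (.sStar e) * gen K (.s f)) 0
  | regular (v : V) (S : Finset E) (hS : ∀ e, e ∈ S ↔ G.s e = v) (hne : S.Nonempty) :
      Rel K G (gen K (.p {v} (.singleton v))) (∑ e ∈ S, gen K (.s e) * gen K (.sStar e))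
  | smul (k : K) {a b : FreeAlg K G} : Rel K G a b → Rel K G (k • a) (k • b)

/-- The congruence of the free algebra generated by the defining relations. -/
noncomputable def con (K : Type*) [Field K] {V E : Type*} (G : Ultragraph V E) : RingCon (FreeAlg K G) :=
  ringConGen (Rel K G)

/-- The Leavitt path algebra `L_K(G)`: the `K`-algebra, in general without unit, presented by the
symbols `p_A`, `s_e`, `s_e^*` and the defining relations. -/
def LeavittPathAlgebra (K : Type*) [Field K] {V E : Type*} (G : Ultragraph V E) :=
  (con K G).Quotient

namespace LeavittPathAlgebra

noncomputable instance (K : Type*) [Field K] {V E : Type*} (G : Ultragraph V E) :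
    NonUnitalRing (LeavittPathAlgebra K G) :=
  inferInstanceAs (NonUnitalRing (con K G).Quotient)

theorem con_smul {K : Type*} [Field K] {V E : Type*} {G : Ultragraph V E} (k : K)
    {a b : FreeAlg K G} (h : con K G a b) : con K G (k • a) (k • b) := by
  have h' : RingConGen.Rel (Rel K G) a b := h
  change RingConGen.Rel (Rel K G) (k • a) (k • b)
  clear h
  induction h' with
  | of x y h => exact .of _ _ (.smul k h)
  | refl x => exact .refl _
  | symm _ ih => exact ih.symm
  | trans _ _ ih₁ ih₂ => exact ih₁.trans ih₂
  | add _ _ ih₁ ih₂ => simpa only [smul_add] using ih₁.add ih₂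
  | mul _ h₂ ih₁ _ => simpa only [smul_mul_assoc] using ih₁.mul h₂

/-- The quotient map from the free algebra. -/
noncomputable def mk (K : Type*) [Field K] {V E : Type*} (G : Ultragraph V E) (a : FreeAlg K G) :
    LeavittPathAlgebra K G :=
  RingCon.toQuotient (c := con K G) a

noncomputable instance (K : Type*) [Field K] {V E : Type*} (G : Ultragraph V E) :
    SMul K (LeavittPathAlgebra K G) where
  smul k := Quotient.map' (k • ·) fun _ _ h => con_smul k h

theorem mk_surjective (K : Type*) [Field K] {V E : Type*} (G : Ultragraph V E) :
    Function.Surjective (mk K G) :=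
  Quotient.mk''_surjective

noncomputable instance (K : Type*) [Field K] {V E : Type*} (G : Ultragraph V E) :
    Module K (LeavittPathAlgebra K G) :=
  Function.Surjective.module K
    ({ toFun := mk K G, map_zero' := rfl, map_add' := fun _ _ => rfl } :
      FreeAlg K G →+ LeavittPathAlgebra K G)
    (mk_surjective K G) (fun _ _ => rfl)

instance (K : Type*) [Field K] {V E : Type*} (G : Ultragraph V E) :
    IsScalarTower K (LeavittPathAlgebra K G) (LeavittPathAlgebra K G) where
  smul_assoc k x y := by
    obtain ⟨a, rfl⟩ := mk_surjective K G x
    obtain ⟨b, rfl⟩ := mk_surjective K G y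
    exact congrArg (mk K G) (smul_mul_assoc k a b)

instance (K : Type*) [Field K] {V E : Type*} (G : Ultragraph V E) :
    SMulCommClass K (LeavittPathAlgebra K G) (LeavittPathAlgebra K G) where
  smul_comm k x y := by
    obtain ⟨a, rfl⟩ := mk_surjective K G x
    obtain ⟨b, rfl⟩ := mk_surjective K G y
    exact congrArg (mk K G) (mul_smul_comm k a b).symm

end LeavittPathAlgebra

end Ultragraph

namespace NonUnitalRing

/-- A left module `M` over a ring `R` without unit, given by its structure map
`ρ : R → End(M, +)`, is simple if `R M ≠ 0` and `M` has no submodules other than `0` and `M`. -/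
def IsSimpleModule {R M : Type*} [NonUnitalRing R] [AddCommGroup M]
    (ρ : R →ₙ+* AddMonoid.End M) : Prop :=
  (∃ r m, ρ r m ≠ 0) ∧
    ∀ N : AddSubgroup M, (∀ r, ∀ m ∈ N, ρ r m ∈ N) → N = ⊥ ∨ N = ⊤

/-- The (left) primitive ideals: the annihilators of the simple left modules. Every simple module
is cyclic, hence isomorphic to a module in the universe of `R`. -/
def IsPrimitiveIdeal.{u} {R : Type u} [NonUnitalRing R] (P : TwoSidedIdeal R) : Prop :=
  ∃ (M : Type u) (_ : AddCommGroup M) (ρ : R →ₙ+* AddMonoid.End M),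
    IsSimpleModule ρ ∧ P = TwoSidedIdeal.ker ρ

/-- The Jacobson radical: the intersection of the annihilators of all simple left modules. -/
def jacobsonRadical (R : Type*) [NonUnitalRing R] : TwoSidedIdeal R :=
  sInf {P | IsPrimitiveIdeal P}

/-- A ring is semiprimitive if its Jacobson radical is zero. -/
def IsSemiprimitive (R : Type*) [NonUnitalRing R] : Prop :=
  jacobsonRadical R = ⊥

end NonUnitalRing

/-! Suppose `a ≠ 0` lies in the radical. Right multiplication strips the ghost edges from `a`
(`exists_pathComb`), and the ghost of a shortest remaining path, followed by `p_v`, turns the result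
into `k • p_v + y` with `k ≠ 0` and `y` a combination of closed paths of positive length at `v`
(`PathComb.exists_ghost`). This element is still in the radical.

If `y = 0`, the nonzero idempotent `p_v` is in the radical, which is impossible. Otherwise put `u =
k⁻¹ • y`. Then `u + u²` is in the radical, so `p_v + u + u²` has a right inverse `w = p_v w`.
Degrees refute this (`PathComb.not_exists_right_inverse`): the lowest term of `w` must have degree
0, so its highest degree `N` is nonnegative. If `m` is the top degree of `u`, the component of `u`
in degree `m` is left cancellable, so the product has a nonzero term in degree `N + 2m > 0`.

Degrees are read off in Laurent polynomials over an operator algebra (`degreeHom`). The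
representation behind it (`exists_rep`) need not be faithful; it only has to keep every `p_v`
nonzero. As there may be no unit, radical elements are controlled through left ideals maximal among
those avoiding an idempotent `e` and containing all `x - x e`. -/

namespace Ultragraph

namespace LeavittPathAlgebra

variable {K : Type*} [Field K] {V E : Type*} {G : Ultragraph V E}

/-! ### Generators and their relations -/

variable (K) in
/-- The idempotent `p_A`. -/
noncomputable def P (A : Set V) (hA : G.IsGenVertex A) : LeavittPathAlgebra K G :=
  mk K G (gen K (.p A hA))

variable (K G) in
/-- The idempotent `p_v` of a vertex. -/
noncomputable def pv (v : V) : LeavittPathAlgebra K G := P K {v} (.singleton v)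

variable (K G) in
/-- The element `s_e`. -/
noncomputable def S (e : E) : LeavittPathAlgebra K G := mk K G (gen K (.s e))

variable (K G) in
/-- The element `s_e^*`. -/
noncomputable def T (e : E) : LeavittPathAlgebra K G := mk K G (gen K (.sStar e))

theorem mk_eq_of_rel {a b : FreeAlg K G} (h : Rel K G a b) : mk K G a = mk K G b :=
  Quotient.sound' (RingConGen.Rel.of _ _ h)

theorem mk_mul (a b : FreeAlg K G) : mk K G (a * b) = mk K G a * mk K G b := rfl

theorem mk_add (a b : FreeAlg K G) : mk K G (a + b) = mk K G a + mk K G b := rfl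

theorem mk_smul (k : K) (a : FreeAlg K G) : mk K G (k • a) = k • mk K G a := rfl

theorem mk_sum {ι : Type*} (s : Finset ι) (f : ι → FreeAlg K G) :
    mk K G (∑ i ∈ s, f i) = ∑ i ∈ s, mk K G (f i) := by
  classical
  induction s using Finset.induction_on with
  | empty => rfl
  | insert a s ha ih => rw [Finset.sum_insert ha, Finset.sum_insert ha, mk_add, ih]

theorem P_congr {A B : Set V} (h : A = B) (hA : G.IsGenVertex A) (hB : G.IsGenVertex B) :
    P K A hA = P K B hB := by
  subst h; rfl

theorem P_empty (h : G.IsGenVertex ∅) : P K ∅ h = 0 := mk_eq_of_rel .p_empty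

theorem P_mul_P {A B : Set V} (hA : G.IsGenVertex A) (hB : G.IsGenVertex B) :
    P K A hA * P K B hB = P K (A ∩ B) (hA.inter hB) := mk_eq_of_rel (.p_mul hA hB)

theorem P_mul_P_of_subset {A B : Set V} (hA : G.IsGenVertex A) (hB : G.IsGenVertex B)
    (h : A ⊆ B) : P K A hA * P K B hB = P K A hA := by
  rw [P_mul_P]; exact P_congr (Set.inter_eq_left.2 h) _ _

theorem P_mul_P_of_superset {A B : Set V} (hA : G.IsGenVertex A) (hB : G.IsGenVertex B)
    (h : B ⊆ A) : P K A hA * P K B hB = P K B hB := by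
  rw [P_mul_P]; exact P_congr (Set.inter_eq_right.2 h) _ _

theorem P_mul_P_of_disjoint {A B : Set V} (hA : G.IsGenVertex A) (hB : G.IsGenVertex B)
    (h : Disjoint A B) : P K A hA * P K B hB = 0 := by
  rw [P_mul_P, P_congr (Set.disjoint_iff_inter_eq_empty.1 h) _ .empty, P_empty]

theorem P_inter_add_P_diff {A B : Set V} (hA : G.IsGenVertex A) (hB : G.IsGenVertex B) :
    P K (B ∩ A) (hB.inter hA) + P K (B \ A) (hB.diff hA) = P K B hB := by
  have h : P K ((B ∩ A) ∪ (B \ A)) ((hB.inter hA).union (hB.diff hA)) =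
      P K (B ∩ A) (hB.inter hA) + P K (B \ A) (hB.diff hA) -
        P K ((B ∩ A) ∩ (B \ A)) ((hB.inter hA).inter (hB.diff hA)) :=
    mk_eq_of_rel (.p_union _ _)
  rw [P_congr (Set.inter_union_sdiff B A) _ hB,
    P_congr (show (B ∩ A) ∩ (B \ A) = ∅ by grind) _ .empty,
    P_empty, sub_zero] at h
  exact h.symm

theorem pv_mul_self (v : V) : pv K G v * pv K G v = pv K G v :=
  P_mul_P_of_subset _ _ subset_rfl

theorem pv_mul_pv_of_ne {v w : V} (h : v ≠ w) : pv K G v * pv K G w = 0 :=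
  P_mul_P_of_disjoint _ _ (by simpa using h)

theorem pv_mul_P {v : V} {A : Set V} (hA : G.IsGenVertex A) (h : v ∈ A) :
    pv K G v * P K A hA = pv K G v :=
  P_mul_P_of_subset _ _ (by simpa using h)

theorem P_mul_pv {v : V} {A : Set V} (hA : G.IsGenVertex A) (h : v ∈ A) :
    P K A hA * pv K G v = pv K G v :=
  P_mul_P_of_superset _ _ (by simpa using h)

theorem pv_mul_P_of_notMem {v : V} {A : Set V} (hA : G.IsGenVertex A) (h : v ∉ A) :
    pv K G v * P K A hA = 0 :=
  P_mul_P_of_disjoint _ _ (by simpa using h)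

theorem P_mul_pv_of_notMem {v : V} {A : Set V} (hA : G.IsGenVertex A) (h : v ∉ A) :
    P K A hA * pv K G v = 0 :=
  P_mul_P_of_disjoint _ _ (by simpa using h)

theorem pv_mul_S (e : E) : pv K G (G.s e) * S K G e = S K G e := mk_eq_of_rel (.source_s e)

theorem S_mul_P (e : E) : S K G e * P K (G.r e) (.range e) = S K G e :=
  mk_eq_of_rel (.s_range e)

theorem P_mul_T (e : E) : P K (G.r e) (.range e) * T K G e = T K G e :=
  mk_eq_of_rel (.range_sStar e)

theorem T_mul_pv (e : E) : T K G e * pv K G (G.s e) = T K G e := mk_eq_of_rel (.sStar_source e)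

theorem T_mul_S (e : E) : T K G e * S K G e = P K (G.r e) (.range e) :=
  mk_eq_of_rel (.sStar_s_self e)

theorem T_mul_S_of_ne {e f : E} (h : e ≠ f) : T K G e * S K G f = 0 :=
  mk_eq_of_rel (.sStar_s_of_ne h)

theorem pv_eq_sum (v : V) (F : Finset E) (hF : ∀ e, e ∈ F ↔ G.s e = v) (hne : F.Nonempty) :
    pv K G v = ∑ e ∈ F, S K G e * T K G e := by
  have := mk_eq_of_rel (Rel.regular (K := K) v F hF hne)
  rwa [mk_sum] at this

theorem P_mul_S_of_mem {A : Set V} (hA : G.IsGenVertex A) {e : E} (h : G.s e ∈ A) :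
    P K A hA * S K G e = S K G e := by
  rw [← pv_mul_S, ← mul_assoc, P_mul_pv hA h]

theorem P_mul_S_of_notMem {A : Set V} (hA : G.IsGenVertex A) {e : E} (h : G.s e ∉ A) :
    P K A hA * S K G e = 0 := by
  rw [← pv_mul_S, ← mul_assoc, P_mul_pv_of_notMem hA h, zero_mul]

theorem T_mul_P_of_mem {A : Set V} (hA : G.IsGenVertex A) {e : E} (h : G.s e ∈ A) :
    T K G e * P K A hA = T K G e := by
  rw [← T_mul_pv, mul_assoc, pv_mul_P hA h]

theorem T_mul_P_of_notMem {A : Set V} (hA : G.IsGenVertex A) {e : E} (h : G.s e ∉ A) :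
    T K G e * P K A hA = 0 := by
  rw [← T_mul_pv, mul_assoc, pv_mul_P_of_notMem hA h, mul_zero]

/-! ### The universal property -/

section Lift

variable {B : Type*} [NonUnitalRing B] [Module K B] [IsScalarTower K B B] [SMulCommClass K B B]

/-- A family of elements of a `K`-algebra satisfying the relations of the Leavitt path algebra. -/
structure Family (K : Type*) [Field K] {V E : Type*} (G : Ultragraph V E) (B : Type*)
    [NonUnitalRing B] where
  /-- the images of the `p_A` -/
  p : Set V → B
  /-- the images of the `s_e` -/
  s : E → B
  /-- the images of the `s_e^*` -/
  t : E → B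
  p_empty : p ∅ = 0
  p_mul : ∀ {A B}, G.IsGenVertex A → G.IsGenVertex B → p A * p B = p (A ∩ B)
  p_union : ∀ {A B}, G.IsGenVertex A → G.IsGenVertex B → p (A ∪ B) = p A + p B - p (A ∩ B)
  p_mul_s : ∀ e, p {G.s e} * s e = s e
  s_mul_p : ∀ e, s e * p (G.r e) = s e
  p_mul_t : ∀ e, p (G.r e) * t e = t e
  t_mul_p : ∀ e, t e * p {G.s e} = t e
  t_mul_s : ∀ e, t e * s e = p (G.r e)
  t_mul_s_of_ne : ∀ {e f}, e ≠ f → t e * s f = 0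
  p_eq_sum : ∀ (v : V) (F : Finset E), (∀ e, e ∈ F ↔ G.s e = v) → F.Nonempty →
    p {v} = ∑ e ∈ F, s e * t e

/-- The value of a family at a generator. -/
def Family.val (φ : Family K G B) : G.Gen → B
  | .p A _ => φ.p A
  | .s e => φ.s e
  | .sStar e => φ.t e

/-- The homomorphism from the free algebra induced by a family. -/
noncomputable def Family.freeLift (φ : Family K G B) : FreeAlg K G →ₙₐ[K] B :=
  MonoidAlgebra.liftMagma K (FreeSemigroup.lift φ.val)

theorem Family.freeLift_gen (φ : Family K G B) (x : G.Gen) : φ.freeLift (gen K x) = φ.val x := by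
  simp [freeLift, gen]

theorem Family.freeLift_eq_of_rel (φ : Family K G B) {a b : FreeAlg K G} (h : Rel K G a b) :
    φ.freeLift a = φ.freeLift b := by
  induction h with
  | p_empty => simpa [freeLift_gen, val] using φ.p_empty
  | p_mul hA hB => simpa [freeLift_gen, val] using φ.p_mul hA hB
  | p_union hA hB => simpa [freeLift_gen, val] using φ.p_union hA hB
  | source_s e => simpa [freeLift_gen, val] using φ.p_mul_s e
  | s_range e => simpa [freeLift_gen, val] using φ.s_mul_p e
  | range_sStar e => simpa [freeLift_gen, val] using φ.p_mul_t e
  | sStar_source e => simpa [freeLift_gen, val] using φ.t_mul_p e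
  | sStar_s_self e => simpa [freeLift_gen, val] using φ.t_mul_s e
  | sStar_s_of_ne h => simpa [freeLift_gen, val] using φ.t_mul_s_of_ne h
  | regular v F hF hne => simpa [freeLift_gen, val] using φ.p_eq_sum v F hF hne
  | smul k _ ih => rw [map_smul, map_smul, ih]

theorem Family.freeLift_eq_of_con (φ : Family K G B) {a b : FreeAlg K G} (h : con K G a b) :
    φ.freeLift a = φ.freeLift b := by
  have h' : RingConGen.Rel (Rel K G) a b := h
  clear h
  induction h' with
  | of x y h => exact φ.freeLift_eq_of_rel h
  | refl x => rfl
  | symm _ ih => exact ih.symm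
  | trans _ _ ih₁ ih₂ => exact ih₁.trans ih₂
  | add _ _ ih₁ ih₂ => rw [map_add, map_add, ih₁, ih₂]
  | mul _ _ ih₁ ih₂ => rw [map_mul, map_mul, ih₁, ih₂]

/-- The homomorphism from the Leavitt path algebra induced by a family. -/
noncomputable def Family.lift (φ : Family K G B) : LeavittPathAlgebra K G →ₙₐ[K] B where
  toFun := Quotient.lift φ.freeLift fun _ _ h => φ.freeLift_eq_of_con h
  map_smul' k x := by
    obtain ⟨a, rfl⟩ := mk_surjective K G x
    exact map_smul φ.freeLift k a
  map_zero' := map_zero φ.freeLift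
  map_add' x y := by
    obtain ⟨a, rfl⟩ := mk_surjective K G x
    obtain ⟨b, rfl⟩ := mk_surjective K G y
    exact map_add φ.freeLift a b
  map_mul' x y := by
    obtain ⟨a, rfl⟩ := mk_surjective K G x
    obtain ⟨b, rfl⟩ := mk_surjective K G y
    exact map_mul φ.freeLift a b

theorem Family.lift_P (φ : Family K G B) {A : Set V} (hA : G.IsGenVertex A) :
    φ.lift (P K A hA) = φ.p A := φ.freeLift_gen _

theorem Family.lift_S (φ : Family K G B) (e : E) : φ.lift (S K G e) = φ.s e := φ.freeLift_gen _

end Lift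

/-- Every element of the Leavitt path algebra lies in a subset that contains the generators and is
closed under linear combinations and under right multiplication by generators. -/
theorem induction_right {C : LeavittPathAlgebra K G → Prop}
    (gens : ∀ x : G.Gen, C (mk K G (gen K x))) (zero : C 0) (add : ∀ x y, C x → C y → C (x + y))
    (smul : ∀ (k : K) x, C x → C (k • x))
    (mul : ∀ y (x : G.Gen), C y → C (y * mk K G (gen K x))) (a : LeavittPathAlgebra K G) : C a := by
  have key : ∀ w : FreeSemigroup G.Gen, C (mk K G (MonoidAlgebra.single w 1)) ∧
      ∀ y, C y → C (y * mk K G (MonoidAlgebra.single w 1)) := by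
    intro w
    refine FreeSemigroup.recOnMul w (fun x => ⟨gens x, fun y hy => mul y x hy⟩) ?_
    intro x w hx hw
    have h : (MonoidAlgebra.single (FreeSemigroup.of x * w) 1 : FreeAlg K G) =
        MonoidAlgebra.single (FreeSemigroup.of x) 1 * MonoidAlgebra.single w 1 := by
      rw [MonoidAlgebra.single_mul_single, mul_one]
    rw [h, mk_mul]
    exact ⟨hw.2 _ hx.1, fun y hy => by rw [← mul_assoc]; exact hw.2 _ (hx.2 y hy)⟩
  obtain ⟨a, rfl⟩ := mk_surjective K G a
  induction a using MonoidAlgebra.induction_linear with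
  | zero => exact zero
  | add f g hf hg => exact add _ _ hf hg
  | single w k =>
    have h : (MonoidAlgebra.single w k : FreeAlg K G) = k • MonoidAlgebra.single w 1 := by simp
    rw [h, mk_smul]
    exact smul _ _ (key w).1

/-! ### A representation in which no vertex acts as zero -/

/-- A branching system: a bijection that decomposes every point over an emitter uniquely as an
edge followed by a point over the range of that edge. -/
theorem exists_branching [Countable V] [Countable E] (G : Ultragraph V E) :
    ∃ Θ : {q : E × (V × ℕ) // q.2.1 ∈ G.r q.1} ≃ {y : V × ℕ // ∃ e, G.s e = y.1},
      ∀ q, (Θ q).1.1 = G.s q.1.1 := by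
  let f : {q : E × (V × ℕ) // q.2.1 ∈ G.r q.1} → V := fun q => G.s q.1.1
  let g : {y : V × ℕ // ∃ e, G.s e = y.1} → V := fun y => y.1.1
  -- Over an emitter both fibres are countably infinite, thanks to the factor `ℕ`; over a sink both
  -- are empty.
  have key : ∀ v, Nonempty ({q // f q = v} ≃ {y // g y = v}) := by
    intro v
    by_cases hv : ∃ e, G.s e = v
    · obtain ⟨e, he⟩ := hv
      obtain ⟨u, hu⟩ := G.r_nonempty e
      have : Infinite {q // f q = v} :=
        Infinite.of_injective (fun n : ℕ => ⟨⟨(e, (u, n)), hu⟩, he⟩) fun m n h => by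
          simpa using h
      have : Infinite {y // g y = v} :=
        Infinite.of_injective (fun n : ℕ => ⟨⟨(v, n), e, he⟩, rfl⟩) fun m n h => by
          simpa using h
      exact nonempty_equiv_of_countable
    · have : IsEmpty {q // f q = v} := ⟨fun q => hv ⟨_, q.2⟩⟩
      have : IsEmpty {y // g y = v} := ⟨fun y => hv (by obtain ⟨⟨y, e, he⟩, rfl⟩ := y; exact ⟨e, he⟩)⟩
      exact ⟨Equiv.equivOfIsEmpty _ _⟩
  refine ⟨(Equiv.sigmaFiberEquiv f).symm.trans ((Equiv.sigmaCongrRight fun v => (key v).some).trans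
    (Equiv.sigmaFiberEquiv g)), fun q => ?_⟩
  exact ((key (f q)).some ⟨q, rfl⟩).2

open Classical in
/-- The family of operators on functions that is induced by a branching system. -/
noncomputable def branchingFamily (K : Type*) [Field K]
    (Θ : {q : E × (V × ℕ) // q.2.1 ∈ G.r q.1} ≃ {y : V × ℕ // ∃ e, G.s e = y.1})
    (hΘ : ∀ q, (Θ q).1.1 = G.s q.1.1) : Family K G (Module.End K (V × ℕ → K)) where
  p A :=
    { toFun := fun g x => if x.1 ∈ A then g x else 0
      map_add' := fun g h => by ext x; by_cases hx : x.1 ∈ A <;> simp [hx]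
      map_smul' := fun k g => by ext x; by_cases hx : x.1 ∈ A <;> simp [hx] }
  s e :=
    -- `s_e` transports a function along `x ↦ Θ (e, x)` and extends it by zero; `s_e^*` pulls back
    -- along the same map.
    { toFun := fun g y => if h : ∃ e, G.s e = y.1 then
        (if (Θ.symm ⟨y, h⟩).1.1 = e then g (Θ.symm ⟨y, h⟩).1.2 else 0) else 0
      map_add' := fun g h => by ext x; simp only [Pi.add_apply]; split_ifs <;> simp
      map_smul' := fun k g => by
        ext x; simp only [Pi.smul_apply, RingHom.id_apply]; split_ifs <;> simp }
  t e :=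
    { toFun := fun g x => if h : x.1 ∈ G.r e then g (Θ ⟨(e, x), h⟩).1 else 0
      map_add' := fun g h => by ext x; simp only [Pi.add_apply]; split_ifs <;> simp
      map_smul' := fun k g => by
        ext x; simp only [Pi.smul_apply, RingHom.id_apply]; split_ifs <;> simp }
  p_empty := by ext; simp
  p_mul hA hB := by
    refine LinearMap.ext fun g => funext fun x => ?_
    simp only [Module.End.mul_apply, LinearMap.coe_mk, AddHom.coe_mk, Set.mem_inter_iff]
    split_ifs <;> simp_all
  p_union {A B} hA hB := by
    refine LinearMap.ext fun g => funext fun x => ?_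
    by_cases h : x.1 ∈ A <;> by_cases h' : x.1 ∈ B <;> simp [h, h']
  p_mul_s e := by
    refine LinearMap.ext fun g => funext fun x => ?_
    simp only [Module.End.mul_apply, LinearMap.coe_mk, AddHom.coe_mk, Set.mem_singleton_iff]
    have := fun h => hΘ (Θ.symm ⟨x, h⟩)
    split_ifs <;> simp_all
  s_mul_p e := by
    refine LinearMap.ext fun g => funext fun x => ?_
    simp only [Module.End.mul_apply, LinearMap.coe_mk, AddHom.coe_mk]
    have := fun h => (Θ.symm ⟨x, h⟩).2
    split_ifs <;> simp_all
  p_mul_t e := by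
    refine LinearMap.ext fun g => funext fun x => ?_
    simp only [Module.End.mul_apply, LinearMap.coe_mk, AddHom.coe_mk]
    split_ifs <;> simp_all
  t_mul_p e := by
    refine LinearMap.ext fun g => funext fun x => ?_
    simp only [Module.End.mul_apply, LinearMap.coe_mk, AddHom.coe_mk, Set.mem_singleton_iff, hΘ,
      if_true]
  t_mul_s e := by
    refine LinearMap.ext fun g => funext fun x => ?_
    simp only [Module.End.mul_apply, LinearMap.coe_mk, AddHom.coe_mk]
    by_cases h : x.1 ∈ G.r e
    · rw [dif_pos h, if_pos h, dif_pos (Θ ⟨(e, x), h⟩).2]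
      simp
    · rw [dif_neg h, if_neg h]
  t_mul_s_of_ne {e f} hef := by
    refine LinearMap.ext fun g => funext fun x => ?_
    simp only [Module.End.mul_apply, LinearMap.coe_mk, AddHom.coe_mk]
    by_cases h : x.1 ∈ G.r e
    · rw [dif_pos h, dif_pos (Θ ⟨(e, x), h⟩).2, if_neg (by simpa using hef)]
      rfl
    · rw [dif_neg h]
      rfl
  p_eq_sum v F hF hne := by
    refine LinearMap.ext fun g => funext fun y => ?_
    simp only [LinearMap.sum_apply, Finset.sum_apply, Module.End.mul_apply, LinearMap.coe_mk,
      AddHom.coe_mk, Set.mem_singleton_iff]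
    -- A point over an emitter lies in the image of exactly one edge, so a single summand survives.
    by_cases hy : ∃ e, G.s e = y.1
    · obtain ⟨⟨⟨e, x⟩, hx⟩, hq⟩ := Θ.surjective ⟨y, hy⟩
      have hs : G.s e = y.1 := by have := hΘ ⟨(e, x), hx⟩; rw [hq] at this; exact this.symm
      simp only [hy, dif_pos, ← hq, Equiv.symm_apply_apply]
      have hx' : x.1 ∈ G.r e := hx
      simp only [hF, hs, Finset.sum_ite_eq, dif_pos hx', hq]
    · have hv : y.1 ≠ v := by
        rintro rfl
        obtain ⟨e, he⟩ := hne
        exact hy ⟨e, (hF e).1 he⟩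
      simp [hy, hv]

/-- `p_v` acts as restriction to the nonempty set `{v} × ℕ`, hence moves the constant function 1 to
a nonzero one. -/
theorem exists_rep [Countable V] [Countable E] (K : Type*) [Field K] (G : Ultragraph V E) :
    ∃ π : LeavittPathAlgebra K G →ₙₐ[K] Module.End K (V × ℕ → K), ∀ v, π (pv K G v) ≠ 0 := by
  obtain ⟨Θ, hΘ⟩ := exists_branching G
  refine ⟨(branchingFamily K Θ hΘ).lift, fun v h => ?_⟩
  rw [pv, Family.lift_P] at h
  have := congrFun (LinearMap.congr_fun h fun _ => 1) (v, 0)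
  simp [branchingFamily] at this

/-! ### The degree -/

section Degree

variable {A : Type*} [Ring A] [Algebra K A]

/-- The family that puts `p_A`, `s_e`, `s_e^*` into degrees `0`, `1`, `-1`. -/
noncomputable def degreeFamily (π : LeavittPathAlgebra K G →ₙₐ[K] A) :
    Family K G (AddMonoidAlgebra A ℤ) where
  -- The value 0 off the generalized vertices is arbitrary: no relation refers to those sets.
  p A := by classical exact if h : G.IsGenVertex A then .single 0 (π (P K A h)) else 0
  s e := .single 1 (π (S K G e))
  t e := .single (-1) (π (T K G e))
  p_empty := by simp [P_empty]
  p_mul hA hB := by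
    simp [hA, hB, hA.inter hB, AddMonoidAlgebra.single_mul_single,
      -LaurentPolynomial.single_eq_C_mul_T, ← map_mul, P_mul_P]
  p_union {A B} hA hB := by
    have : P K (A ∪ B) (hA.union hB) = P K A hA + P K B hB - P K (A ∩ B) (hA.inter hB) :=
      mk_eq_of_rel (.p_union hA hB)
    simp [hA, hB, hA.inter hB, hA.union hB, this]
  p_mul_s e := by
    have := pv_mul_S (K := K) (G := G) e
    rw [pv] at this
    simp [Ultragraph.IsGenVertex.singleton, AddMonoidAlgebra.single_mul_single,
      -LaurentPolynomial.single_eq_C_mul_T, ← map_mul, this]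
  s_mul_p e := by
    simp [Ultragraph.IsGenVertex.range, AddMonoidAlgebra.single_mul_single,
      -LaurentPolynomial.single_eq_C_mul_T, ← map_mul, S_mul_P]
  p_mul_t e := by
    simp [Ultragraph.IsGenVertex.range, AddMonoidAlgebra.single_mul_single,
      -LaurentPolynomial.single_eq_C_mul_T, ← map_mul, P_mul_T]
  t_mul_p e := by
    have := T_mul_pv (K := K) (G := G) e
    rw [pv] at this
    simp [Ultragraph.IsGenVertex.singleton, AddMonoidAlgebra.single_mul_single,
      -LaurentPolynomial.single_eq_C_mul_T, ← map_mul, this]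
  t_mul_s e := by
    simp [Ultragraph.IsGenVertex.range, AddMonoidAlgebra.single_mul_single,
      -LaurentPolynomial.single_eq_C_mul_T, ← map_mul, T_mul_S]
  t_mul_s_of_ne h := by
    simp [AddMonoidAlgebra.single_mul_single,
      -LaurentPolynomial.single_eq_C_mul_T, ← map_mul, T_mul_S_of_ne h]
  p_eq_sum v F hF hne := by
    have := pv_eq_sum (K := K) v F hF hne
    rw [pv] at this
    simp [Ultragraph.IsGenVertex.singleton, AddMonoidAlgebra.single_mul_single,
      -LaurentPolynomial.single_eq_C_mul_T, this, map_sum]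
    exact map_sum (AddMonoidAlgebra.singleAddHom (0 : ℤ)) _ _

/-- The homomorphism into Laurent polynomials that records the degree. -/
noncomputable def degreeHom (π : LeavittPathAlgebra K G →ₙₐ[K] A) :
    LeavittPathAlgebra K G →ₙₐ[K] AddMonoidAlgebra A ℤ :=
  (degreeFamily π).lift

theorem degreeHom_P (π : LeavittPathAlgebra K G →ₙₐ[K] A) {B : Set V} (hB : G.IsGenVertex B) :
    degreeHom π (P K B hB) = .single 0 (π (P K B hB)) := by
  rw [degreeHom, Family.lift_P]; simp [degreeFamily, hB]

theorem degreeHom_pv (π : LeavittPathAlgebra K G →ₙₐ[K] A) (v : V) :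
    degreeHom π (pv K G v) = .single 0 (π (pv K G v)) := degreeHom_P π _

theorem degreeHom_S (π : LeavittPathAlgebra K G →ₙₐ[K] A) (e : E) :
    degreeHom π (S K G e) = .single 1 (π (S K G e)) := Family.lift_S _ _

end Degree

/-! ### Paths -/

variable (K G) in
/-- Left multiplication by `s_α` for a word `α` in the edges. -/
noncomputable def path : List E → LeavittPathAlgebra K G →ₗ[K] LeavittPathAlgebra K G
  -- The algebra may lack a unit, so the empty word makes sense only as an operator.
  | [] => LinearMap.id
  | e :: α => LinearMap.mulLeft K (S K G e) ∘ₗ path α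

variable (K G) in
/-- Left multiplication by `s_α^*` for a word `α` in the edges. -/
noncomputable def ghost : List E → LeavittPathAlgebra K G →ₗ[K] LeavittPathAlgebra K G
  | [] => LinearMap.id
  | e :: α => ghost α ∘ₗ LinearMap.mulLeft K (T K G e)

@[simp] theorem path_nil (x : LeavittPathAlgebra K G) : path K G [] x = x := rfl

@[simp] theorem path_cons (e : E) (α : List E) (x : LeavittPathAlgebra K G) :
    path K G (e :: α) x = S K G e * path K G α x := rfl

@[simp] theorem ghost_nil (x : LeavittPathAlgebra K G) : ghost K G [] x = x := rfl

@[simp] theorem ghost_cons (e : E) (α : List E) (x : LeavittPathAlgebra K G) :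
    ghost K G (e :: α) x = ghost K G α (T K G e * x) := rfl

theorem path_mul (α : List E) (x y : LeavittPathAlgebra K G) :
    path K G α (x * y) = path K G α x * y := by
  induction α with
  | nil => rfl
  | cons e α ih => simp [ih, mul_assoc]

theorem ghost_mul (α : List E) (x y : LeavittPathAlgebra K G) :
    ghost K G α (x * y) = ghost K G α x * y := by
  induction α generalizing x with
  | nil => rfl
  | cons e α ih => simp [← ih, mul_assoc]

theorem path_append (α β : List E) (x : LeavittPathAlgebra K G) :
    path K G (α ++ β) x = path K G α (path K G β x) := by
  induction α with
  | nil => rfl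
  | cons e α ih => simp [ih]

variable (G) in
/-- The source of a word in the edges, considered as a path that ends in `v`. -/
def src (v : V) : List E → V
  | [] => v
  | e :: _ => G.s e

variable (G) in
/-- A word in the edges is a path that ends in `v`. -/
def IsPath (v : V) : List E → Prop
  | [] => True
  | e :: α => src G v α ∈ G.r e ∧ IsPath v α

theorem pv_src_mul_path (v : V) (α : List E) :
    pv K G (src G v α) * path K G α (pv K G v) = path K G α (pv K G v) := by
  cases α with
  | nil => exact pv_mul_self v
  | cons e α => simp [src, ← mul_assoc, pv_mul_S]

theorem pv_mul_path_of_ne {v w : V} {α : List E} (h : w ≠ src G v α) :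
    pv K G w * path K G α (pv K G v) = 0 := by
  rw [← pv_src_mul_path, ← mul_assoc, pv_mul_pv_of_ne h, zero_mul]

theorem path_mul_pv (v : V) (α : List E) :
    path K G α (pv K G v) * pv K G v = path K G α (pv K G v) := by
  rw [← path_mul, pv_mul_self]

theorem IsPath.of_append {v : V} {α β : List E} (h : IsPath G v (α ++ β)) : IsPath G v β := by
  induction α with
  | nil => exact h
  | cons e α ih => exact ih h.2

theorem ghost_path_append {v : V} {α β : List E} (h : IsPath G v (α ++ β)) :
    ghost K G α (path K G (α ++ β) (pv K G v)) = path K G β (pv K G v) := by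
  induction α with
  | nil => rfl
  | cons e α ih =>
    have hs : src G v (α ++ β) ∈ G.r e := h.1
    rw [List.cons_append, ghost_cons, path_cons, ← mul_assoc, T_mul_S, ← pv_src_mul_path,
      ← mul_assoc, P_mul_pv _ hs, pv_src_mul_path, ih h.2]

theorem ghost_path_self {v : V} {α : List E} (h : IsPath G v α) :
    ghost K G α (path K G α (pv K G v)) = pv K G v := by
  have h' : IsPath G v (α ++ []) := by simpa using h
  simpa using ghost_path_append (K := K) h'

/-- At the first position where the words differ, `s_e^* s_f = 0` applies. The length bound excludes
that `β` is a proper prefix of `α`, in which case a ghost path would remain. -/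
theorem ghost_path_eq_zero {v : V} {α β : List E} (hβ : IsPath G v β)
    (hl : α.length ≤ β.length) (h : ¬ α <+: β) :
    ghost K G α (path K G β (pv K G v)) = 0 := by
  induction α generalizing β with
  | nil => exact absurd List.nil_prefix h
  | cons e α ih =>
    cases β with
    | nil => simp at hl
    | cons f β =>
      rw [ghost_cons, path_cons, ← mul_assoc]
      by_cases hef : e = f
      · subst hef
        rw [T_mul_S, ← pv_src_mul_path, ← mul_assoc, P_mul_pv _ hβ.1, pv_src_mul_path]
        refine ih hβ.2 (by simpa using hl) fun h' => h ?_
        simpa using h'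
      · rw [T_mul_S_of_ne hef, zero_mul, map_zero]

/-- If the set `B` is contained in or disjoint from the range of each edge of a word that is not a
path ending in the point `v` of `B`, then the corresponding product is zero. -/
theorem path_P_eq_zero {B : Set V} (hB : G.IsGenVertex B) {v : V} (hv : v ∈ B) {α : List E}
    (hd : ∀ e ∈ α, B ⊆ G.r e ∨ Disjoint B (G.r e)) (h : ¬ IsPath G v α) :
    path K G α (P K B hB) = 0 := by
  induction α with
  | nil => exact absurd trivial h
  | cons e α ih =>
    by_cases h' : IsPath G v α
    · have hs : src G v α ∉ G.r e := fun hs => h ⟨hs, h'⟩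
      rw [path_cons]
      cases α with
      | nil =>
        rcases hd e (by simp) with hd | hd
        · exact absurd (hd hv) hs
        · rw [path_nil, ← S_mul_P, mul_assoc, P_mul_P_of_disjoint _ _ hd.symm, mul_zero]
      | cons f α =>
        rw [path_cons, ← mul_assoc, ← S_mul_P, mul_assoc (S K G e), P_mul_S_of_notMem _ hs,
          mul_zero, zero_mul]
    · rw [path_cons, ih (fun e he => hd e (List.mem_cons_of_mem _ he)) h', mul_zero]

theorem path_pv_eq_zero {v : V} {α : List E} (h : ¬ IsPath G v α) :
    path K G α (pv K G v) = 0 :=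
  path_P_eq_zero _ (Set.mem_singleton v) (fun e _ => by
    by_cases h : v ∈ G.r e
    · exact .inl (by simpa using h)
    · exact .inr (by simpa using h)) h

/-- A nontrivial linear combination of paths that end in `v`. -/
structure PathComb (K : Type*) [Field K] {V E : Type*} (G : Ultragraph V E) (v : V) where
  /-- the paths -/
  words : Finset (List E)
  /-- the coefficients -/
  c : List E → K
  c_ne_zero : ∀ α ∈ words, c α ≠ 0
  isPath : ∀ α ∈ words, IsPath G v α

/-- The element of the Leavitt path algebra given by a combination of paths. -/
noncomputable def PathComb.val {v : V} (x : PathComb K G v) : LeavittPathAlgebra K G :=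
  ∑ α ∈ x.words, x.c α • path K G α (pv K G v)

theorem PathComb.val_mul_pv {v : V} (x : PathComb K G v) : x.val * pv K G v = x.val := by
  simp only [val, Finset.sum_mul, smul_mul_assoc, path_mul_pv]

/-- Multiplication by a ghost path turns a combination of paths into the sum of a nonzero scalar
and a combination of closed paths of positive length. -/
theorem PathComb.exists_ghost {v : V} (x : PathComb K G v) (hx : x.words.Nonempty) :
    ∃ (α : List E) (k : K) (y : PathComb K G v), k ≠ 0 ∧ (∀ β ∈ y.words, β ≠ [] ∧ src G v β = v) ∧
      pv K G v * ghost K G α x.val = k • pv K G v + y.val := by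
  classical
  -- By minimality, the ghost of `α` kills every word that does not extend `α`.
  obtain ⟨α, hα, hmin⟩ := x.words.exists_min_image List.length hx
  -- The surviving tails: `p_v` on the left kills those that do not start at `v`, and the empty
  -- tail, from `α` itself, supplies the scalar term.
  let T : Finset (List E) := (x.words.image (List.drop α.length)).filter fun β =>
    β ≠ [] ∧ src G v β = v ∧ α ++ β ∈ x.words
  have hT : ∀ {β}, β ∈ T ↔ β ≠ [] ∧ src G v β = v ∧ α ++ β ∈ x.words := by
    intro β
    simp only [T, Finset.mem_filter, Finset.mem_image, and_iff_right_iff_imp]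
    rintro ⟨-, -, h⟩
    exact ⟨_, h, by simp⟩
  refine ⟨α, x.c α, ⟨T, fun β => x.c (α ++ β), fun β hβ => x.c_ne_zero _ (hT.1 hβ).2.2,
    fun β hβ => (x.isPath _ (hT.1 hβ).2.2).of_append⟩, x.c_ne_zero _ hα,
    fun β hβ => ⟨(hT.1 hβ).1, (hT.1 hβ).2.1⟩, ?_⟩
  simp only [val, map_sum, map_smul, Finset.mul_sum, mul_smul_comm]
  have hsub : insert α (T.image (α ++ ·)) ⊆ x.words := by
    intro β hβ
    rcases Finset.mem_insert.1 hβ with rfl | hβ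
    · exact hα
    · obtain ⟨γ, hγ, rfl⟩ := Finset.mem_image.1 hβ
      exact (hT.1 hγ).2.2
  rw [← Finset.sum_subset hsub, Finset.sum_insert, Finset.sum_image]
  · congr 1
    · rw [ghost_path_self (x.isPath _ hα), pv_mul_self]
    · refine Finset.sum_congr rfl fun β hβ => ?_
      obtain ⟨-, h₁, h₂⟩ := hT.1 hβ
      have := pv_src_mul_path (K := K) (G := G) v β
      rw [h₁] at this
      rw [ghost_path_append (x.isPath _ h₂), this]
  · intro β _ γ _ h
    simpa using h
  · simp only [Finset.mem_image, not_exists, not_and]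
    intro β hβ h
    exact (hT.1 hβ).1 (by simpa using h)
  · intro β hβ hβ'
    by_cases h : α <+: β
    · obtain ⟨γ, rfl⟩ := h
      rw [ghost_path_append (x.isPath _ hβ), pv_mul_path_of_ne, smul_zero]
      intro hv
      refine hβ' (Finset.mem_insert.2 ?_)
      by_cases hγ : γ = []
      · exact .inl (by simp [hγ])
      · exact .inr (Finset.mem_image_of_mem _ (hT.2 ⟨hγ, hv.symm, hβ⟩))
    · rw [ghost_path_eq_zero (x.isPath _ hβ) (hmin β hβ) h, mul_zero, smul_zero]

section Degree

variable {A : Type*} [Ring A] [Algebra K A]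

theorem degreeHom_path (π : LeavittPathAlgebra K G →ₙₐ[K] A) (v : V) (α : List E) :
    degreeHom π (path K G α (pv K G v)) = .single (α.length : ℤ) (π (path K G α (pv K G v))) := by
  induction α with
  | nil => exact degreeHom_pv π v
  | cons e α ih =>
    rw [path_cons, map_mul, map_mul, ih, degreeHom_S, AddMonoidAlgebra.single_mul_single,
      List.length_cons, Nat.cast_succ, add_comm]

theorem degreeHom_val (π : LeavittPathAlgebra K G →ₙₐ[K] A) {v : V} (x : PathComb K G v) :
    degreeHom π x.val =
      ∑ α ∈ x.words, .single (α.length : ℤ) (x.c α • π (path K G α (pv K G v))) := by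
  rw [PathComb.val, map_sum]
  refine Finset.sum_congr rfl fun α _ => ?_
  rw [map_smul, degreeHom_path, AddMonoidAlgebra.smul_single]

theorem coeff_degreeHom_val_mul (π : LeavittPathAlgebra K G →ₙₐ[K] A) {v : V} (x : PathComb K G v)
    (f : AddMonoidAlgebra A ℤ) (n : ℤ) :
    (degreeHom π x.val * f).coeff n =
      ∑ α ∈ x.words, (x.c α • π (path K G α (pv K G v))) * f.coeff (n - α.length) := by
  rw [degreeHom_val, Finset.sum_mul, AddMonoidAlgebra.coeff_sum, Finset.sum_apply']
  refine Finset.sum_congr rfl fun α _ => ?_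
  rw [AddMonoidAlgebra.coeff_single_mul_apply, neg_add_eq_sub]

end Degree

section Degree

variable {A : Type*} [Ring A] [Algebra K A]

/-- For `x` homogeneous of degree `n`, the words of `y` push `x` into degrees above `n`, so the
degree `n` part of the product is `k • π x`. -/
theorem rep_eq_zero_of_mul_eq_zero (π : LeavittPathAlgebra K G →ₙₐ[K] A) {v : V} {k : K}
    (hk : k ≠ 0) (y : PathComb K G v) (hy : ∀ β ∈ y.words, β ≠ []) {x : LeavittPathAlgebra K G} {n : ℤ}
    (hn : degreeHom π x = .single n (π x)) (hx : pv K G v * x = x)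
    (h : (k • pv K G v + y.val) * x = 0) : π x = 0 := by
  rw [add_mul, smul_mul_assoc, hx] at h
  have h' := congrArg (fun z => (degreeHom π z).coeff n) h
  simp only [map_add, map_smul, map_mul, map_zero, AddMonoidAlgebra.coeff_add, Finsupp.add_apply,
    coeff_degreeHom_val_mul, hn] at h'
  rw [Finset.sum_eq_zero, add_zero] at h'
  · simpa [-LaurentPolynomial.single_eq_C_mul_T, hk] using h'
  · intro β hβ
    have : (β.length : ℤ) ≠ 0 := by simpa using hy β hβ
    have h' : n ≠ n - β.length := by lia
    simp [-LaurentPolynomial.single_eq_C_mul_T, h']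

end Degree

theorem rep_S_ne_zero {A : Type*} [Ring A] [Algebra K A] (π : LeavittPathAlgebra K G →ₙₐ[K] A)
    (hπ : ∀ v, π (pv K G v) ≠ 0) (e : E) : π (S K G e) ≠ 0 := by
  intro h
  obtain ⟨v, hv⟩ := G.r_nonempty e
  apply hπ v
  rw [← P_mul_pv (.range e) hv, ← T_mul_S, map_mul, map_mul, h, mul_zero, zero_mul]

section Nonvanishing

variable [Countable V] [Countable E]

theorem PathComb.val_ne_zero {v : V} (x : PathComb K G v) (hx : x.words.Nonempty) : x.val ≠ 0 := by
  intro h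
  obtain ⟨π, hπ⟩ := exists_rep K G
  obtain ⟨α, k, y, hk, hy, h'⟩ := x.exists_ghost hx
  rw [h, map_zero, mul_zero] at h'
  exact hπ v (rep_eq_zero_of_mul_eq_zero π hk y (fun β hβ => (hy β hβ).1) (degreeHom_pv π v)
    (pv_mul_self v) (by rw [← h', zero_mul]))

theorem PathComb.val_mul_S_ne_zero {e : E} (x : PathComb K G (G.s e)) (hx : x.words.Nonempty) :
    x.val * S K G e ≠ 0 := by
  intro h
  obtain ⟨π, hπ⟩ := exists_rep K G
  obtain ⟨α, k, y, hk, hy, h'⟩ := x.exists_ghost hx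
  refine rep_S_ne_zero π hπ e (rep_eq_zero_of_mul_eq_zero π hk y (fun β hβ => (hy β hβ).1)
    (degreeHom_S π e) (pv_mul_S e) ?_)
  rw [← h', mul_assoc, ← ghost_mul, h, map_zero, mul_zero]

end Nonvanishing

/-! ### Reduction to a combination of paths -/

/-- A nonzero element stays nonzero after multiplication by `p_B` for a suitable `B` that is
contained in or disjoint from each of finitely many given sets. -/
theorem exists_decided (L : List (Set V)) (hL : ∀ A ∈ L, G.IsGenVertex A)
    (x : LeavittPathAlgebra K G) {B : Set V} (hB : G.IsGenVertex B) (hx : x * P K B hB ≠ 0) :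
    ∃ (C : Set V) (hC : G.IsGenVertex C), C ⊆ B ∧ x * P K C hC ≠ 0 ∧
      ∀ A ∈ L, C ⊆ A ∨ Disjoint C A := by
  induction L generalizing B with
  | nil => exact ⟨B, hB, subset_rfl, hx, by simp⟩
  | cons A L ih =>
    have hA := hL A (by simp)
    replace ih := fun {B} => @ih (fun A' h => hL A' (List.mem_cons_of_mem _ h)) B
    rw [← P_inter_add_P_diff hA hB, mul_add] at hx
    by_cases h : x * P K (B ∩ A) (hB.inter hA) = 0
    · rw [h, zero_add] at hx
      obtain ⟨C, hC, hCB, hxC, hd⟩ := ih _ hx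
      refine ⟨C, hC, hCB.trans Set.sdiff_subset, hxC, fun A' hA' => ?_⟩
      rcases List.mem_cons.1 hA' with rfl | hA'
      · exact .inr (Set.disjoint_of_subset_left hCB Set.disjoint_sdiff_left)
      · exact hd A' hA'
    · obtain ⟨C, hC, hCB, hxC, hd⟩ := ih _ h
      refine ⟨C, hC, hCB.trans Set.inter_subset_left, hxC, fun A' hA' => ?_⟩
      rcases List.mem_cons.1 hA' with rfl | hA'
      · exact .inl (hCB.trans Set.inter_subset_right)
      · exact hd A' hA'

variable (K G) in
/-- The span of the products `s_α p_A`. -/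
noncomputable def pathSpan : Submodule K (LeavittPathAlgebra K G) :=
  Submodule.span K {x | ∃ (α : List E) (A : Set V) (hA : G.IsGenVertex A),
    x = path K G α (P K A hA)}

theorem path_P_mem (α : List E) {A : Set V} (hA : G.IsGenVertex A) :
    path K G α (P K A hA) ∈ pathSpan K G := Submodule.subset_span ⟨α, A, hA, rfl⟩

theorem exists_mul_P_eq {a : LeavittPathAlgebra K G} (ha : a ∈ pathSpan K G) :
    ∃ (B : Set V) (hB : G.IsGenVertex B), a * P K B hB = a := by
  induction ha using Submodule.span_induction with
  | mem x hx =>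
    obtain ⟨α, A, hA, rfl⟩ := hx
    exact ⟨A, hA, by rw [← path_mul, P_mul_P_of_subset _ _ subset_rfl]⟩
  | zero => exact ⟨∅, .empty, zero_mul _⟩
  | add x y _ _ hx hy =>
    obtain ⟨B, hB, hx⟩ := hx
    obtain ⟨C, hC, hy⟩ := hy
    refine ⟨B ∪ C, hB.union hC, ?_⟩
    rw [add_mul]
    congr 1
    · rw [← hx, mul_assoc, P_mul_P_of_subset _ _ Set.subset_union_left]
    · rw [← hy, mul_assoc, P_mul_P_of_subset _ _ Set.subset_union_right]
  | smul k x _ hx =>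
    obtain ⟨B, hB, hx⟩ := hx
    exact ⟨B, hB, by rw [smul_mul_assoc, hx]⟩

/-- Below a set `B` decided by all the `A` that occur, each `p_A` acts as 1 or 0. The coefficients
thus depend on `B` alone, which allows one choice to serve both a smaller set and a single vertex in
it. -/
theorem exists_coefficients {a : LeavittPathAlgebra K G} (ha : a ∈ pathSpan K G) :
    ∃ L : List (Set V), (∀ A ∈ L, G.IsGenVertex A) ∧ ∀ B : Set V,
      (∀ A ∈ L, B ⊆ A ∨ Disjoint B A) → ∃ c : List E →₀ K, ∀ (C : Set V) (hC : G.IsGenVertex C),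
        C ⊆ B → a * P K C hC = c.sum fun α k => k • path K G α (P K C hC) := by
  induction ha using Submodule.span_induction with
  | mem x hx =>
    obtain ⟨α, A, hA, rfl⟩ := hx
    refine ⟨[A], by simpa using hA, fun B hB => ?_⟩
    rcases hB A (by simp) with hB | hB
    · refine ⟨Finsupp.single α 1, fun C hC hCB => ?_⟩
      rw [← path_mul, P_mul_P_of_superset _ _ (hCB.trans hB)]
      simp
    · refine ⟨0, fun C hC hCB => ?_⟩
      rw [← path_mul, P_mul_P_of_disjoint _ _ (Set.disjoint_of_subset_left hCB hB).symm]
      simp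
  | zero => exact ⟨[], by simp, fun B _ => ⟨0, by simp⟩⟩
  | add x y _ _ hx hy =>
    obtain ⟨L, hL, hx⟩ := hx
    obtain ⟨M, hM, hy⟩ := hy
    refine ⟨L ++ M, fun A hA => (List.mem_append.1 hA).elim (hL A) (hM A), fun B hB => ?_⟩
    obtain ⟨c, hc⟩ := hx B fun A hA => hB A (List.mem_append_left _ hA)
    obtain ⟨d, hd⟩ := hy B fun A hA => hB A (List.mem_append_right _ hA)
    refine ⟨c + d, fun C hC hCB => ?_⟩
    classical
    rw [add_mul, hc C hC hCB, hd C hC hCB, Finsupp.sum_add_index'] <;> simp [add_smul]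
  | smul k x _ hx =>
    obtain ⟨L, hL, hx⟩ := hx
    refine ⟨L, hL, fun B hB => ?_⟩
    obtain ⟨c, hc⟩ := hx B hB
    refine ⟨k • c, fun C hC hCB => ?_⟩
    rw [smul_mul_assoc, hc C hC hCB, Finsupp.sum_smul_index' (by simp), Finsupp.smul_sum]
    simp [mul_smul]

theorem exists_pathComb_of_mem_pathSpan {a : LeavittPathAlgebra K G} (ha : a ∈ pathSpan K G)
    (h0 : a ≠ 0) : ∃ (v : V) (x : PathComb K G v), x.words.Nonempty ∧ a * pv K G v = x.val := by
  classical
  obtain ⟨B₀, hB₀, h₀⟩ := exists_mul_P_eq ha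
  obtain ⟨L, hL, hc⟩ := exists_coefficients ha
  obtain ⟨B₁, hB₁, -, h₁, hd₁⟩ := exists_decided L hL a hB₀ (by rwa [h₀])
  obtain ⟨c, hc⟩ := hc B₁ hd₁
  -- A second refinement decides the ranges of all edges in the words. Then `s_α p_B = 0` unless `α`
  -- is a path ending in `v`, for any chosen `v ∈ B`; since `a p_B ≠ 0`, some word is such a path.
  obtain ⟨B, hB, hBB, h₂, hd⟩ := exists_decided (c.support.toList.flatten.map G.r)
    (by simp only [List.mem_map]; rintro _ ⟨e, -, rfl⟩; exact .range e) a hB₁ h₁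
  replace hd : ∀ α ∈ c.support, ∀ e ∈ α, B ⊆ G.r e ∨ Disjoint B (G.r e) := fun α hα e he =>
    hd _ (List.mem_map_of_mem (List.mem_flatten.2 ⟨α, by simpa using hα, he⟩))
  have hne : B.Nonempty := by
    rw [Set.nonempty_iff_ne_empty]
    rintro rfl
    exact h₂ (by rw [P_empty, mul_zero])
  obtain ⟨v, hv⟩ := hne
  refine ⟨v, ⟨c.support.filter (IsPath G v), c, fun α hα => ?_, fun α hα => ?_⟩, ?_, ?_⟩
  · simpa using (Finset.mem_filter.1 hα).1
  · exact (Finset.mem_filter.1 hα).2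
  · rw [Finset.nonempty_iff_ne_empty]
    intro he
    rw [hc B hB hBB] at h₂
    refine h₂ (Finset.sum_eq_zero fun α hα => ?_)
    dsimp only
    rw [path_P_eq_zero hB hv (hd α hα), smul_zero]
    exact Finset.filter_eq_empty_iff.1 he hα
  · rw [pv, hc {v} _ (by simpa using hBB hv), PathComb.val, Finset.sum_filter]
    refine Finset.sum_congr rfl fun α _ => ?_
    split_ifs with h
    · rfl
    · dsimp only
      rw [← pv, path_pv_eq_zero h, smul_zero]

theorem pathSpan_mul_P {a : LeavittPathAlgebra K G} (ha : a ∈ pathSpan K G) {B : Set V}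
    (hB : G.IsGenVertex B) : a * P K B hB ∈ pathSpan K G := by
  induction ha using Submodule.span_induction with
  | mem x hx =>
    obtain ⟨α, A, hA, rfl⟩ := hx
    rw [← path_mul, P_mul_P]
    exact path_P_mem _ _
  | zero => rw [zero_mul]; exact zero_mem _
  | add x y _ _ hx hy => rw [add_mul]; exact add_mem hx hy
  | smul k x _ hx => rw [smul_mul_assoc]; exact Submodule.smul_mem _ _ hx

theorem pathSpan_mul_S {a : LeavittPathAlgebra K G} (ha : a ∈ pathSpan K G) (e : E) :
    a * S K G e ∈ pathSpan K G := by
  induction ha using Submodule.span_induction with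
  | mem x hx =>
    obtain ⟨α, A, hA, rfl⟩ := hx
    by_cases h : G.s e ∈ A
    · have : path K G (α ++ [e]) (P K (G.r e) (.range e)) ∈ pathSpan K G := path_P_mem _ _
      rwa [path_append, path_cons, path_nil, S_mul_P, ← P_mul_S_of_mem hA h, path_mul] at this
    · rw [← path_mul, P_mul_S_of_notMem hA h, map_zero]
      exact zero_mem _
  | zero => rw [zero_mul]; exact zero_mem _
  | add x y _ _ hx hy => rw [add_mul]; exact add_mem hx hy
  | smul k x _ hx => rw [smul_mul_assoc]; exact Submodule.smul_mem _ _ hx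

/-! ### Elimination of ghost edges -/

variable (K G) in
/-- Membership in the span of the products `s_α p_A s_β^*` with `β` of length at most `n`. -/
def MemFiltration : ℕ → LeavittPathAlgebra K G → Prop
  | 0, x => x ∈ pathSpan K G
  | n + 1, x => ∃ a ∈ pathSpan K G, ∃ b : E →₀ LeavittPathAlgebra K G,
      (∀ e, MemFiltration n (b e)) ∧ x = a + b.sum fun e y => y * T K G e

namespace MemFiltration

variable {n : ℕ} {x y : LeavittPathAlgebra K G}

theorem of_pathSpan (h : x ∈ pathSpan K G) : MemFiltration K G n x := by
  induction n generalizing x with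
  | zero => exact h
  | succ n ih => exact ⟨x, h, 0, fun _ => ih (zero_mem _), by simp⟩

theorem add (hx : MemFiltration K G n x) (hy : MemFiltration K G n y) :
    MemFiltration K G n (x + y) := by
  classical
  induction n generalizing x y with
  | zero => exact add_mem (S := Submodule K _) hx hy
  | succ n ih =>
    obtain ⟨a, ha, b, hb, rfl⟩ := hx
    obtain ⟨a', ha', b', hb', rfl⟩ := hy
    refine ⟨a + a', add_mem ha ha', b + b', fun e => ih (hb e) (hb' e), ?_⟩
    rw [Finsupp.sum_add_index' (by simp) (by simp [add_mul])]
    abel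

theorem smul (k : K) (hx : MemFiltration K G n x) : MemFiltration K G n (k • x) := by
  induction n generalizing x with
  | zero => exact Submodule.smul_mem _ k hx
  | succ n ih =>
    obtain ⟨a, ha, b, hb, rfl⟩ := hx
    refine ⟨k • a, Submodule.smul_mem _ k ha, k • b, fun e => ih (hb e), ?_⟩
    rw [Finsupp.sum_smul_index' (by simp), smul_add, Finsupp.smul_sum]
    simp only [smul_mul_assoc]

theorem zero : MemFiltration K G n 0 := of_pathSpan (zero_mem _)

theorem sum {ι : Type*} (s : Finset ι) (f : ι → LeavittPathAlgebra K G)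
    (h : ∀ i ∈ s, MemFiltration K G n (f i)) : MemFiltration K G n (∑ i ∈ s, f i) :=
  Finset.sum_induction _ _ (fun _ _ => add) zero h

theorem mul_T (hx : MemFiltration K G n x) (e : E) : MemFiltration K G (n + 1) (x * T K G e) := by
  classical
  refine ⟨0, zero_mem _, Finsupp.single e x, fun f => ?_, by simp⟩
  rw [Finsupp.single_apply]
  split_ifs
  · exact hx
  · exact zero

theorem succ (hx : MemFiltration K G n x) : MemFiltration K G (n + 1) x := by
  induction n generalizing x with
  | zero => exact of_pathSpan hx
  | succ n ih =>
    obtain ⟨a, ha, b, hb, rfl⟩ := hx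
    exact ⟨a, ha, b, fun e => ih (hb e), rfl⟩

theorem mono {m : ℕ} (h : n ≤ m) (hx : MemFiltration K G n x) : MemFiltration K G m x := by
  induction h with
  | refl => exact hx
  | step _ ih => exact ih.succ

theorem mul_P (hx : MemFiltration K G n x) {B : Set V} (hB : G.IsGenVertex B) :
    MemFiltration K G n (x * P K B hB) := by
  cases n with
  | zero => exact pathSpan_mul_P hx hB
  | succ n =>
    obtain ⟨a, ha, b, hb, rfl⟩ := hx
    rw [add_mul, Finsupp.sum, Finset.sum_mul]
    refine add (of_pathSpan (pathSpan_mul_P ha hB)) (sum _ _ fun e _ => ?_)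
    rw [mul_assoc]
    by_cases h : G.s e ∈ B
    · rw [T_mul_P_of_mem hB h]
      exact (hb e).mul_T e
    · rw [T_mul_P_of_notMem hB h, mul_zero]
      exact zero

/-- `s_e^* s_f` removes the last ghost edge, which is what makes induction on the ghost length
possible. -/
theorem mul_S_succ (hx : MemFiltration K G (n + 1) x) (f : E) :
    MemFiltration K G n (x * S K G f) := by
  obtain ⟨a, ha, b, hb, rfl⟩ := hx
  rw [add_mul, Finsupp.sum, Finset.sum_mul]
  refine add (of_pathSpan (pathSpan_mul_S ha f)) (sum _ _ fun e _ => ?_)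
  rw [mul_assoc]
  by_cases h : e = f
  · subst h
    rw [T_mul_S]
    exact (hb e).mul_P _
  · rw [T_mul_S_of_ne h, mul_zero]
    exact zero

end MemFiltration

theorem exists_memFiltration (x : LeavittPathAlgebra K G) : ∃ n, MemFiltration K G n x := by
  induction x using induction_right with
  | gens x =>
    cases x with
    | p A hA => exact ⟨0, path_P_mem [] hA⟩
    | s e => exact ⟨0, by
        have : path K G [e] (P K (G.r e) (.range e)) ∈ pathSpan K G := path_P_mem _ _
        rwa [path_cons, path_nil, S_mul_P] at this⟩
    | sStar e => exact ⟨1, by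
        have := MemFiltration.mul_T (n := 0) (path_P_mem (K := K) (G := G) [] (.range e)) e
        rwa [path_nil, P_mul_T] at this⟩
  | zero => exact ⟨0, .zero⟩
  | add x y hx hy =>
    obtain ⟨m, hx⟩ := hx
    obtain ⟨n, hy⟩ := hy
    exact ⟨max m n, (hx.mono (le_max_left _ _)).add (hy.mono (le_max_right _ _))⟩
  | smul k x hx =>
    obtain ⟨n, hx⟩ := hx
    exact ⟨n, hx.smul k⟩
  | mul y x hy =>
    obtain ⟨n, hy⟩ := hy
    cases x with
    | p A hA => exact ⟨n, hy.mul_P hA⟩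
    | s e => exact ⟨n, hy.succ.mul_S_succ e⟩
    | sStar e => exact ⟨n + 1, hy.mul_T e⟩

section Reduction

variable [Countable V] [Countable E]

/-- If `a p_{s(e)} ≠ 0`, it restricts to a nontrivial path combination at some vertex, necessarily
`s(e)`, and `s_e` does not kill such a combination. -/
theorem mul_pv_eq_zero_of_mul_S_eq_zero {a : LeavittPathAlgebra K G} (ha : a ∈ pathSpan K G)
    {e : E} (h : a * S K G e = 0) : a * pv K G (G.s e) = 0 := by
  by_contra h0
  obtain ⟨w, x, hx, hax⟩ := exists_pathComb_of_mem_pathSpan (pathSpan_mul_P ha _) h0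
  change a * pv K G (G.s e) * pv K G w = x.val at hax
  by_cases hw : G.s e = w
  · subst hw
    apply x.val_mul_S_ne_zero hx
    rw [← hax, mul_assoc, mul_assoc, pv_mul_S, pv_mul_S, h]
  · apply x.val_ne_zero hx
    rw [← hax, mul_assoc, pv_mul_pv_of_ne hw, mul_zero]

/-- If `a = a' + ∑ b_e s_e^*` with `a'` free of ghosts is annihilated by all `s_e` then `a` is in
the span of the products `s_α p_A`. -/
theorem mem_pathSpan_of_mul_S_eq_zero {a : LeavittPathAlgebra K G} (ha : a ∈ pathSpan K G)
    (b : E →₀ LeavittPathAlgebra K G)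
    (h : ∀ e, (a + b.sum fun e y => y * T K G e) * S K G e = 0) :
    (a + b.sum fun e y => y * T K G e) ∈ pathSpan K G := by
  classical
  have hS : ∀ f, (b.sum fun e y => y * T K G e) * S K G f = b f * P K (G.r f) (.range f) := by
    intro f
    rw [Finsupp.sum, Finset.sum_mul, Finset.sum_eq_single f]
    · rw [mul_assoc, T_mul_S]
    · intro e _ hef
      rw [mul_assoc, T_mul_S_of_ne hef, mul_zero]
    · intro hf
      rw [Finsupp.notMem_support_iff.1 hf, zero_mul, zero_mul]
  -- Annihilation by `s_e` reads `b_e p_{r(e)} = -a s_e`; multiply by `s_e^*`.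
  have hb : ∀ e, b e * T K G e = -(a * S K G e * T K G e) := by
    intro e
    have := h e
    rw [add_mul, hS, add_comm, add_eq_zero_iff_eq_neg] at this
    rw [← P_mul_T, ← mul_assoc, this, neg_mul, P_mul_T]
  have hv : ∀ v ∈ b.support.image G.s,
      ∑ e ∈ b.support with G.s e = v, b e * T K G e = -(a * pv K G v) := by
    intro v hv
    obtain ⟨e₀, he₀, hs⟩ := Finset.mem_image.1 hv
    -- If the support contains all edges out of `v`, then `v` is regular and `∑ s_e s_e^* = p_v`. If
    -- an edge `f` is missing, then `a s_f = 0`, so `a p_v = 0` and both sides vanish.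
    by_cases hF : ∀ e, G.s e = v → e ∈ b.support
    · rw [pv_eq_sum v {e ∈ b.support | G.s e = v}
        (fun e => by simpa using fun h => by simpa using hF e h)
        ⟨e₀, Finset.mem_filter.2 ⟨he₀, hs⟩⟩, Finset.mul_sum, ← Finset.sum_neg_distrib]
      exact Finset.sum_congr rfl fun e _ => by rw [hb, mul_assoc]
    · push Not at hF
      obtain ⟨f, rfl, hf⟩ := hF
      have h0 : a * pv K G (G.s f) = 0 := by
        apply mul_pv_eq_zero_of_mul_S_eq_zero ha
        have := h f
        rwa [add_mul, hS, Finsupp.notMem_support_iff.1 hf, zero_mul, add_zero] at this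
      rw [h0, neg_zero]
      refine Finset.sum_eq_zero fun e he => ?_
      rw [hb, ← pv_mul_S, (Finset.mem_filter.1 he).2, ← mul_assoc, h0, zero_mul, zero_mul, neg_zero]
  rw [Finsupp.sum, ← Finset.sum_fiberwise_of_maps_to (g := G.s) (t := b.support.image G.s)
    fun e he => Finset.mem_image_of_mem _ he, Finset.sum_congr rfl hv]
  exact add_mem ha (sum_mem fun v _ => neg_mem (pathSpan_mul_P ha _))

/-- Every nonzero element has a right multiple that is a nontrivial combination of paths. -/
theorem exists_pathComb {a : LeavittPathAlgebra K G} (ha : a ≠ 0) :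
    ∃ (y : LeavittPathAlgebra K G) (v : V) (x : PathComb K G v), x.words.Nonempty ∧
      a * y = x.val := by
  obtain ⟨n, hn⟩ := exists_memFiltration a
  induction n generalizing a with
  | zero =>
    obtain ⟨v, x, hx, h⟩ := exists_pathComb_of_mem_pathSpan hn ha
    exact ⟨_, v, x, hx, h⟩
  | succ n ih =>
    -- Either some `s_e` lowers the ghost length without killing `a`, or `a` was already free of
    -- ghosts.
    by_cases h : ∀ e, a * S K G e = 0
    · obtain ⟨a', ha', b, -, rfl⟩ := hn
      obtain ⟨v, x, hx, h⟩ :=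
        exists_pathComb_of_mem_pathSpan (mem_pathSpan_of_mul_S_eq_zero ha' b h) ha
      exact ⟨_, v, x, hx, h⟩
    · push Not at h
      obtain ⟨e, he⟩ := h
      obtain ⟨y, v, x, hx, h⟩ := ih he (hn.mul_S_succ e)
      exact ⟨S K G e * y, v, x, hx, by rw [← mul_assoc, h]⟩

end Reduction

end LeavittPathAlgebra

end Ultragraph

/-! ### The radical of a ring without unit, relative to an idempotent -/

namespace NonUnitalRing

variable {R : Type*} [NonUnitalRing R]

/-- Multiplication on the quotient of a ring by a left ideal. -/
def quotientAction (N : AddSubgroup R) (hN : ∀ r, ∀ m ∈ N, r * m ∈ N) :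
    R →ₙ+* AddMonoid.End (R ⧸ N) where
  toFun r := QuotientAddGroup.map N N (AddMonoidHom.mulLeft r) (hN r)
  map_mul' r s := by
    refine AddMonoidHom.ext fun x => ?_
    obtain ⟨x, rfl⟩ := QuotientAddGroup.mk_surjective x
    exact congrArg (QuotientAddGroup.mk (s := N)) (mul_assoc r s x)
  map_zero' := by
    refine AddMonoidHom.ext fun x => ?_
    obtain ⟨x, rfl⟩ := QuotientAddGroup.mk_surjective x
    exact congrArg (QuotientAddGroup.mk (s := N)) (zero_mul x)
  map_add' r s := by
    refine AddMonoidHom.ext fun x => ?_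
    obtain ⟨x, rfl⟩ := QuotientAddGroup.mk_surjective x
    exact congrArg (QuotientAddGroup.mk (s := N)) (add_mul r s x)

/-- Modulo `N` the element `e` is a right identity, so a submodule of `R ⧸ N` containing its class
is everything. By maximality `R ⧸ N` is simple, hence annihilated by `j`. -/
theorem mul_mem_of_mem_jacobsonRadical {e j : R} (hj : j ∈ jacobsonRadical R)
    {N : AddSubgroup R} (hN : ∀ r, ∀ m ∈ N, r * m ∈ N) (he : ∀ x, x - x * e ∈ N) (heN : e ∉ N)
    (hmax : ∀ M : AddSubgroup R, (∀ r, ∀ m ∈ M, r * m ∈ M) → N ≤ M → e ∉ M → M = N) (x : R) :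
    j * x ∈ N := by
  have hs : IsSimpleModule (quotientAction N hN) := by
    constructor
    · refine ⟨e, (e : R), fun h => heN ?_⟩
      have h' : e * e ∈ N := (QuotientAddGroup.eq_zero_iff _).1 h
      simpa using add_mem (he e) h'
    · intro M hM
      let M' : AddSubgroup R := M.comap (QuotientAddGroup.mk' N)
      have hNM : N ≤ M' := by
        intro x hx
        have : (QuotientAddGroup.mk' N) x = 0 := (QuotientAddGroup.eq_zero_iff x).2 hx
        change (QuotientAddGroup.mk' N) x ∈ M
        rw [this]
        exact zero_mem _
      have hM' : ∀ r, ∀ m ∈ M', r * m ∈ M' := fun r m hm => hM r _ hm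
      by_cases heM : e ∈ M'
      · right
        rw [eq_top_iff]
        intro x _
        obtain ⟨x, rfl⟩ := QuotientAddGroup.mk_surjective x
        have : x ∈ M' := by simpa using add_mem (hNM (he x)) (hM' x e heM)
        exact this
      · left
        have h := hmax M' hM' hNM heM
        rw [eq_bot_iff]
        intro x hx
        obtain ⟨x, rfl⟩ := QuotientAddGroup.mk_surjective x
        have hx' : x ∈ M' := hx
        rw [h] at hx'
        exact (QuotientAddGroup.eq_zero_iff x).2 hx'
  have h := (TwoSidedIdeal.mem_sInf R).1 hj _ ⟨R ⧸ N, inferInstance, quotientAction N hN, hs, rfl⟩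
  rw [TwoSidedIdeal.mem_ker] at h
  exact (QuotientAddGroup.eq_zero_iff _).1 (DFunLike.congr_fun h (x : R ⧸ N))

theorem exists_left_inverse_of_mem_jacobsonRadical {e j : R} (hj : j ∈ jacobsonRadical R)
    (he : e * e = e) (hje : j * e = j) : ∃ w, w * (e - j) = e := by
  by_contra h
  push Not at h
  let s : Set (AddSubgroup R) := {N | (∀ r, ∀ m ∈ N, r * m ∈ N) ∧ e ∉ N}
  -- `R(e - j) + R(1 - e)`. Right multiplication by `e` kills the second summand, so `e ∈ N₀` would
  -- give a left inverse.
  let N₀ : AddSubgroup R := (AddMonoidHom.mulRight (e - j)).range ⊔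
    (AddMonoidHom.id R - AddMonoidHom.mulRight e).range
  have hN₀ : N₀ ∈ s := by
    constructor
    · intro r m hm
      obtain ⟨_, ⟨a, rfl⟩, _, ⟨b, rfl⟩, rfl⟩ := AddSubgroup.mem_sup.1 hm
      exact AddSubgroup.mem_sup.2 ⟨_, ⟨r * a, rfl⟩, _, ⟨r * b, rfl⟩, by
        simp [mul_add, mul_sub, mul_assoc]⟩
    · intro hm
      obtain ⟨_, ⟨a, rfl⟩, _, ⟨b, rfl⟩, hab⟩ := AddSubgroup.mem_sup.1 hm
      have hab : a * (e - j) + (b - b * e) = e := hab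
      have := congrArg (· * e) hab
      simp only [add_mul, sub_mul, mul_assoc, he, hje, sub_self, add_zero] at this
      exact h a this
  obtain ⟨N, hN₀N, hN, hmax⟩ := zorn_le_nonempty₀ s (by
    intro c hc hchain M hM
    refine ⟨sSup c, ⟨fun r m hm => ?_, fun hm => ?_⟩, fun z hz => le_sSup hz⟩
    · rw [AddSubgroup.mem_sSup_of_directedOn ⟨M, hM⟩ hchain.directedOn] at hm ⊢
      obtain ⟨L, hL, hm⟩ := hm
      exact ⟨L, hL, (hc hL).1 r m hm⟩
    · rw [AddSubgroup.mem_sSup_of_directedOn ⟨M, hM⟩ hchain.directedOn] at hm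
      obtain ⟨L, hL, hm⟩ := hm
      exact (hc hL).2 hm) N₀ hN₀
  have hj' := mul_mem_of_mem_jacobsonRadical hj hN.1
    (fun x => hN₀N (AddSubgroup.mem_sup_right ⟨x, rfl⟩)) hN.2
    (fun M hM hNM heM => le_antisymm (hmax ⟨hM, heM⟩ hNM) hNM) e
  rw [hje] at hj'
  -- Since `j = j e ∈ N`, the maximal `N` contains `e (e - j) + e j = e`, a contradiction.
  have h₁ : e * (e - j) ∈ N := hN₀N (AddSubgroup.mem_sup_left ⟨e, rfl⟩)
  have h₂ := add_mem h₁ (hN.1 e j hj')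
  rw [mul_sub, sub_add_cancel, he] at h₂
  exact hN.2 h₂

/-- The left inverse `e w e` is again `e` minus a radical element, so it has a left inverse too, and
that must be `e - j`. -/
theorem exists_right_inverse_of_mem_jacobsonRadical {e j : R} (hj : j ∈ jacobsonRadical R)
    (he : e * e = e) (hje : j * e = j) (hej : e * j = j) :
    ∃ w, e * w = w ∧ (e - j) * w = e := by
  obtain ⟨w, hw⟩ := exists_left_inverse_of_mem_jacobsonRadical hj he hje
  have h₁ : e * w * e * (e - j) = e := by
    rw [mul_assoc, mul_sub e e j, he, hej, mul_assoc, hw, he]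
  have h₂ : e * w * e = e + e * w * e * j := by
    rw [mul_sub, mul_assoc (e * w) e e, he] at h₁
    exact sub_eq_iff_eq_add.1 h₁
  obtain ⟨w', hw'⟩ := exists_left_inverse_of_mem_jacobsonRadical (e := e) (j := -(e * w * e * j))
    (neg_mem ((jacobsonRadical R).mul_mem_left _ _ hj)) he (by rw [neg_mul, mul_assoc, hje])
  rw [sub_neg_eq_add, ← h₂] at hw'
  have h₃ : w' * e = e - j := by
    calc w' * e = w' * (e * w * e * (e - j)) := by rw [h₁]
      _ = e - j := by rw [← mul_assoc, hw', mul_sub, he, hej]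
  refine ⟨e * w * e, by simp only [← mul_assoc, he], ?_⟩
  calc (e - j) * (e * w * e) = w' * (e * e * w * e) := by rw [← h₃]; simp only [mul_assoc]
    _ = e := by rw [he, hw']

end NonUnitalRing

/-! ### Degree argument and conclusion -/

namespace Ultragraph

namespace LeavittPathAlgebra

variable {K : Type*} [Field K] {V E : Type*} {G : Ultragraph V E}

theorem PathComb.pv_mul_val {v : V} (y : PathComb K G v) (hy : ∀ β ∈ y.words, src G v β = v) :
    pv K G v * y.val = y.val := by
  rw [val, Finset.mul_sum]
  refine Finset.sum_congr rfl fun β hβ => ?_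
  have := pv_src_mul_path (K := K) (G := G) v β
  rw [hy β hβ] at this
  rw [mul_smul_comm, this]

variable {A : Type*} [Ring A] [Algebra K A]

theorem rep_ghost_mul_eq_zero (π : LeavittPathAlgebra K G →ₙₐ[K] A) (α : List E)
    {x : LeavittPathAlgebra K G} {X : A} (h : π x * X = 0) : π (ghost K G α x) * X = 0 := by
  induction α generalizing x with
  | nil => exact h
  | cons e α ih => exact ih (by rw [LinearMap.mulLeft_apply, map_mul, mul_assoc, h, mul_zero])

/-- Left multiplication by a combination of paths that end in `v` and have the same length is
injective. -/
theorem PathComb.eq_zero_of_rep_mul_eq_zero (π : LeavittPathAlgebra K G →ₙₐ[K] A) {v : V}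
    (y : PathComb K G v) (hy : y.words.Nonempty)
    {m : ℕ} (hm : ∀ β ∈ y.words, β.length = m) {X : A} (hX : π (pv K G v) * X = X)
    (h : π y.val * X = 0) : X = 0 := by
  obtain ⟨α, hα⟩ := hy
  have h' := rep_ghost_mul_eq_zero π α h
  rw [val, map_sum, Finset.sum_eq_single α, map_smul, ghost_path_self (y.isPath α hα), map_smul,
    smul_mul_assoc, hX] at h'
  · exact (smul_eq_zero_iff_right (y.c_ne_zero α hα)).1 h'
  · intro β hβ hne
    rw [map_smul, ghost_path_eq_zero (y.isPath β hβ) (by rw [hm α hα, hm β hβ]), smul_zero]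
    exact fun hp => hne (hp.eq_of_length (by rw [hm α hα, hm β hβ])).symm
  · exact fun h => absurd hα h

theorem PathComb.not_exists_right_inverse [Countable V] [Countable E] {v : V} (y : PathComb K G v)
    (hy : y.words.Nonempty) (hpos : ∀ β ∈ y.words, β ≠ [])
    (hcl : ∀ β ∈ y.words, src G v β = v) (w : LeavittPathAlgebra K G)
    (hw : pv K G v * w = w) : (pv K G v + y.val + y.val * y.val) * w ≠ pv K G v := by
  classical
  intro h
  obtain ⟨π, hπ⟩ := exists_rep K G
  set f := degreeHom π w with hf
  set U := degreeHom π y.val with hU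
  obtain ⟨α, hα, hmax⟩ := y.words.exists_max_image List.length hy
  set m := α.length with hm
  have hmpos : 0 < m := List.length_pos_iff.2 (hpos α hα)
  -- The component of top degree `m`.
  let y' : PathComb K G v := ⟨y.words.filter (fun β => β.length = m), y.c,
    fun β hβ => y.c_ne_zero β (Finset.mem_filter.1 hβ).1,
    fun β hβ => y.isPath β (Finset.mem_filter.1 hβ).1⟩
  have hy'm : ∀ β ∈ y'.words, β.length = m := fun β hβ => (Finset.mem_filter.1 hβ).2
  have hy' : y'.words.Nonempty := ⟨α, Finset.mem_filter.2 ⟨hα, rfl⟩⟩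
  have hfX : ∀ n, π (pv K G v) * f.coeff n = f.coeff n := by
    intro n
    have := congrArg (fun z => (degreeHom π z).coeff n) hw
    simpa [-LaurentPolynomial.single_eq_C_mul_T, map_mul, degreeHom_pv,
      AddMonoidAlgebra.coeff_single_mul_apply] using this
  have heq : ∀ n, f.coeff n + (U * f).coeff n + (U * (U * f)).coeff n =
      (AddMonoidAlgebra.single (0 : ℤ) (π (pv K G v))).coeff n := by
    intro n
    rw [← degreeHom_pv, ← h, add_mul, add_mul, hw, mul_assoc, map_add, map_add, map_mul, map_mul,
      map_mul]
    rfl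
  have hlow : ∀ (g : AddMonoidAlgebra (Module.End K (V × ℕ → K)) ℤ) (M : ℤ),
      (∀ n < M, g.coeff n = 0) → ∀ n ≤ M, (U * g).coeff n = 0 := by
    intro g M hg n hn
    rw [hU, coeff_degreeHom_val_mul]
    refine Finset.sum_eq_zero fun β hβ => ?_
    have := List.length_pos_iff.2 (hpos β hβ)
    rw [hg _ (by lia), mul_zero]
  have hhigh : ∀ (g : AddMonoidAlgebra (Module.End K (V × ℕ → K)) ℤ) (N : ℤ),
      (∀ n > N, g.coeff n = 0) → ∀ n > N + m, (U * g).coeff n = 0 := by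
    intro g N hg n hn
    rw [hU, coeff_degreeHom_val_mul]
    refine Finset.sum_eq_zero fun β hβ => ?_
    have := hmax β hβ
    rw [hg _ (by lia), mul_zero]
  have htop : ∀ (g : AddMonoidAlgebra (Module.End K (V × ℕ → K)) ℤ) (N : ℤ),
      (∀ n > N, g.coeff n = 0) → (U * g).coeff (N + m) = π y'.val * g.coeff N := by
    intro g N hg
    rw [hU, coeff_degreeHom_val_mul, val, map_sum, Finset.sum_mul, Finset.sum_filter]
    refine Finset.sum_congr rfl fun β hβ => ?_
    have := hmax β hβ
    split_ifs with hβm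
    · rw [hβm, add_sub_cancel_right, map_smul]
    · rw [hg _ (by lia), mul_zero]
  have hne : f.coeff.support.Nonempty := by
    rw [Finset.nonempty_iff_ne_empty, Ne, Finsupp.support_eq_empty]
    intro h0
    have hf0 : f = 0 := AddMonoidAlgebra.coeff_injective h0
    have := heq 0
    rw [hf0] at this
    exact hπ v (by simpa [-LaurentPolynomial.single_eq_C_mul_T] using this.symm)
  obtain ⟨M, hM, hMmin⟩ := f.coeff.support.exists_min_image id hne
  obtain ⟨N, hN, hNmax⟩ := f.coeff.support.exists_max_image id hne
  have hfM : ∀ n < M, f.coeff n = 0 := by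
    intro n hn
    by_contra h0
    exact absurd (hMmin n (Finsupp.mem_support_iff.2 h0)) (not_le.2 hn)
  have hfN : ∀ n > N, f.coeff n = 0 := by
    intro n hn
    by_contra h0
    exact absurd (hNmax n (Finsupp.mem_support_iff.2 h0)) (not_le.2 hn)
  -- `U` strictly raises degrees, so in the lowest degree `M` only `f` contributes on the left,
  -- while the right side lives in degree 0.
  have hM0 : M = 0 := by
    by_contra h0
    have h₁ := heq M
    rw [hlow f M hfM M le_rfl, hlow _ M (fun n hn => hlow f M hfM n hn.le) M le_rfl, add_zero,
      add_zero, AddMonoidAlgebra.coeff_single, Finsupp.single_eq_of_ne h0] at h₁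
    exact Finsupp.mem_support_iff.1 hM h₁
  have hMN : M ≤ N := hMmin N hN
  -- In this degree, positive because `N ≥ M = 0`, only the top components of `U`, `U` and `f`
  -- contribute. Cancelling `y'` twice kills the top coefficient of `f`.
  have h₂ := heq (N + m + m)
  rw [hfN _ (by lia), hhigh f N hfN _ (by lia), htop _ (N + m) (hhigh f N hfN), htop f N hfN,
    zero_add, zero_add, AddMonoidAlgebra.coeff_single,
    Finsupp.single_eq_of_ne (by lia)] at h₂
  have h₃ := y'.eq_zero_of_rep_mul_eq_zero π hy' hy'm (by
    rw [← mul_assoc, ← map_mul, y'.pv_mul_val fun β hβ => hcl β (Finset.mem_filter.1 hβ).1]) h₂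
  exact Finsupp.mem_support_iff.1 hN (y'.eq_zero_of_rep_mul_eq_zero π hy' hy'm (hfX N) h₃)

theorem ghost_mem (I : TwoSidedIdeal (LeavittPathAlgebra K G)) (α : List E)
    {x : LeavittPathAlgebra K G} (hx : x ∈ I) : ghost K G α x ∈ I := by
  induction α generalizing x with
  | nil => exact hx
  | cons e α ih => exact ih (I.mul_mem_left _ _ hx)

theorem pv_ne_zero [Countable V] [Countable E] (v : V) : pv K G v ≠ 0 := by
  obtain ⟨π, hπ⟩ := exists_rep K G
  exact fun h => hπ v (by rw [h, map_zero])

theorem eq_zero_of_mem_jacobsonRadical [Countable V] [Countable E] {a : LeavittPathAlgebra K G}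
    (ha : a ∈ NonUnitalRing.jacobsonRadical (LeavittPathAlgebra K G)) : a = 0 := by
  by_contra h0
  obtain ⟨b, v, x, hx, hax⟩ := exists_pathComb h0
  obtain ⟨α, k, y, hk, hy, hz⟩ := x.exists_ghost hx
  have hJ : k • pv K G v + y.val ∈ NonUnitalRing.jacobsonRadical (LeavittPathAlgebra K G) := by
    rw [← hz, ← hax]
    exact TwoSidedIdeal.mul_mem_left _ _ _ (ghost_mem _ _ (TwoSidedIdeal.mul_mem_right _ _ _ ha))
  have he := pv_mul_self (K := K) (G := G) v
  rcases y.words.eq_empty_or_nonempty with hE | hE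
  · have hy0 : y.val = 0 := by rw [PathComb.val, hE, Finset.sum_empty]
    have hJ' := TwoSidedIdeal.mul_mem_left _ (k⁻¹ • pv K G v) _ hJ
    rw [hy0, add_zero, mul_smul_comm, smul_mul_assoc, he, smul_inv_smul₀ hk] at hJ'
    obtain ⟨w, -, hw⟩ := NonUnitalRing.exists_right_inverse_of_mem_jacobsonRadical hJ' he he he
    rw [sub_self, zero_mul] at hw
    exact pv_ne_zero v hw.symm
  · let u : PathComb K G v := ⟨y.words, fun β => k⁻¹ * y.c β,
      fun β hβ => mul_ne_zero (inv_ne_zero hk) (y.c_ne_zero β hβ), y.isPath⟩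
    have hu : u.val = k⁻¹ • y.val := by simp only [PathComb.val, Finset.smul_sum, mul_smul, u]
    have hy' : y.val = k • u.val := by rw [hu, smul_inv_smul₀ hk]
    have huv := u.val_mul_pv
    have hvu := u.pv_mul_val fun β hβ => (hy β hβ).2
    -- Subtracting a multiple of `p_v + u` from `p_v` could leave just `u`, which may be invertible,
    -- as a single loop can be. Multiplying by `u` first gives `p_v + u + u²`, whose terms have
    -- different degrees.
    have hJ' := neg_mem (TwoSidedIdeal.mul_mem_left _ (k⁻¹ • u.val) _ hJ)
    rw [hy', ← smul_add, mul_smul_comm, smul_mul_assoc, smul_inv_smul₀ hk, mul_add, huv] at hJ'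
    obtain ⟨w, hw, h⟩ := NonUnitalRing.exists_right_inverse_of_mem_jacobsonRadical hJ' he
      (by rw [neg_mul, add_mul, mul_assoc, huv]) (by rw [mul_neg, mul_add, ← mul_assoc, hvu])
    rw [sub_neg_eq_add, ← add_assoc] at h
    exact u.not_exists_right_inverse hE (fun β hβ => (hy β hβ).1) (fun β hβ => (hy β hβ).2) w hw h

end LeavittPathAlgebra

end Ultragraph

theorem mainTheorem11 (K : Type*) [Field K] {V E : Type*} [Countable V] [Countable E]
    (G : Ultragraph V E) :
    NonUnitalRing.IsSemiprimitive (Ultragraph.LeavittPathAlgebra K G) := by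
  refine le_antisymm (fun a ha => ?_) bot_le
  exact (TwoSidedIdeal.mem_bot _).2
    (Ultragraph.LeavittPathAlgebra.eq_zero_of_mem_jacobsonRadical ha)
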